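/- Let $\mathbb X$ be a compact metric space (for instance a compact subset of a normed space, with $d(x,x')=\|x-x'\|$), let $\mathbb U$ be a finite non-empty action set, let $c:\mathbb X\times\mathbb U\to\mathbb R$ be a bounded measurable stage-wise cost, let $\mathcal T(\cdot\,|\,x,u)$ be a stochastic kernel from $\mathbb X\times\mathbb U$ to $\mathbb X$, and let $\beta\in(0,1)$. An admissible policy is a sequence $\gamma=(\gamma_t)_{t\ge 0}$ of measurable functions with $U_t=\gamma_t(X_0,\dots,X_t,U_0,\dots,U_{t-1})$, and $$J^*_\beta(x_0)=\inf_{\gamma}E^{\mathcal T,\gamma}_{x_0}\Big[\sum_{t=0}^\infty\beta^t c(X_t,U_t)\Big]$$ is the optimal value function of the Markov decision process $(\mathbb X,\mathbb U,\mathcal T,c)$, the infimum being over all admissible policies. Let $B_1,\dots,B_M$ be disjoint Borel sets with $\bigcup_i B_i=\mathbb X$, let $y_i\in B_i$, let $\mathbb Y=\{y_1,\dots,y_M\}$, and let $\pi^*$ be a probability measure on $\mathbb X$ with $\pi^*(B_i)>0$ for all $i$. Put $\hat\pi^*_{y_i}(A)=\pi^*(A\cap B_i)/\pi^*(B_i)$,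 and let $\hat J_\beta:\mathbb Y\to\mathbb R$ be the optimal value function (again the infimum of the $\beta$-discounted expected cost over all admissible policies) of the finite-state model with state space $\mathbb Y$, action space $\mathbb U$, and $$C^*(y_i,u)=\int_{B_i}c(x,u)\,\hat\pi^*_{y_i}(dx),\qquad P^*(y_j\,|\,y_i,u)=\int_{B_i}\mathcal T(B_j\,|\,x,u)\,\hat\pi^*_{y_i}(dx).$$ Extend $\hat J_\beta$ to $\mathbb X$ by $\hat J_\beta(x)=\hat J_\beta(y_i)$ for $x\in B_i$, and let $\bar L=\max_{i}\sup_{x,x'\in B_i}d(x,x')$. Suppose that there are constants $\alpha_c>0$ and $\alpha_T>0$ with $\beta\alpha_T<1$ such that, for all $x,x'\in\mathbb X$ and $u\in\mathbb U$, $$|c(x,u)-c(x',u)|\le\alpha_c\,d(x,x'),\qquad W_1\big(\mathcal T(\cdot\,|\,x,u),\mathcal T(\cdot\,|\,x',u)\big)\le\alpha_T\,d(x,x'),$$ where $W_1(\mu,\nu)$ is the first order Wasserstein distance, i.e. the infimum of $E[d(X,Y)]$ over all couplings $(X,Y)$ of $\mu$ and $\nu$. Then $$\sup_{x_0\in\mathbb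 X}\big|\hat J_\beta(x_0)-J^*_\beta(x_0)\big|\le\frac{\alpha_c}{(1-\beta\alpha_T)(1-\beta)}\,\bar L .$$ -/

import Mathlib

open MeasureTheory ProbabilityTheory
open scoped ENNReal

noncomputable section

/-- A Markov decision model with state space `S` and action space `U`: a bounded measurable
stage-wise cost `c(x, u)` and a stochastic kernel `T(· | x, u)` on `S` given `S × U`. -/
structure MDP (S U : Type*) [MeasurableSpace S] [MeasurableSpace U] where
  cost : S → U → ℝ
  measurable_cost : Measurable (Function.uncurry cost)
  bounded_cost : ∃ K : ℝ, ∀ x u, |cost x u| ≤ K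
  trans : Kernel (S × U) S
  isMarkov_trans : IsMarkovKernel trans

/-- The information available at time `t`:
`I_t = (X_0, …, X_t, U_0, …, U_{t-1})`. -/
abbrev Info (S U : Type*) (t : ℕ) : Type _ := (Fin (t + 1) → S) × (Fin t → U)

/-- An admissible policy: a sequence of measurable functions `γ_t`, with `U_t = γ_t(I_t)`. -/
structure Policy (S U : Type*) [MeasurableSpace S] [MeasurableSpace U] where
  act : (t : ℕ) → Info S U t → U
  measurable_act : ∀ t, Measurable (act t)

/-- The information `I_{t+1}` formed from the state-action pairs up to time `t` and the
state at time `t + 1`. -/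
def nextInfo {S U : Type*} (t : ℕ) (p : (Finset.Iic t → S × U) × S) : Info S U (t + 1) :=
  (Fin.snoc (α := fun _ => S)
      (fun i : Fin (t + 1) => (p.1 ⟨i, Finset.mem_Iic.2 (Nat.lt_succ_iff.1 i.2)⟩).1) p.2,
    fun i : Fin (t + 1) => (p.1 ⟨i, Finset.mem_Iic.2 (Nat.lt_succ_iff.1 i.2)⟩).2)

theorem measurable_nextInfo {S U : Type*} [MeasurableSpace S] [MeasurableSpace U] (t : ℕ) :
    Measurable (nextInfo (S := S) (U := U) t) := by
  unfold nextInfo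
  refine Measurable.prodMk (measurable_pi_lambda _ fun i => ?_)
    (measurable_pi_lambda _ fun i => by fun_prop)
  induction i using Fin.lastCases with
  | last => simpa using measurable_snd
  | cast j => simp only [Fin.snoc_castSucc]; fun_prop

namespace MDP

variable {S U : Type*} [MeasurableSpace S] [MeasurableSpace U]

/-- The law of `X_{t+1}` given the state-action pairs up to time `t`: it is `T(· | X_t, U_t)`. -/
def nextState (m : MDP S U) (t : ℕ) : Kernel (Finset.Iic t → S × U) S :=
  m.trans.comap (fun h => h ⟨t, Finset.mem_Iic.2 le_rfl⟩) (measurable_pi_apply _)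

instance (m : MDP S U) (t : ℕ) : IsMarkovKernel (m.nextState t) :=
  have := m.isMarkov_trans
  inferInstanceAs (IsMarkovKernel (m.trans.comap _ _))

/-- The law of `(X_{t+1}, U_{t+1})` given the state-action pairs up to time `t`, when
`U_{t+1} = γ_{t+1}(I_{t+1})`. -/
def step (m : MDP S U) (γ : Policy S U) (t : ℕ) : Kernel (Finset.Iic t → S × U) (S × U) :=
  (Kernel.id ×ₖ m.nextState t).map
    (fun p : (Finset.Iic t → S × U) × S => (p.2, γ.act (t + 1) (nextInfo t p)))

instance (m : MDP S U) (γ : Policy S U) (t : ℕ) : IsMarkovKernel (m.step γ t) :=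
  Kernel.IsMarkovKernel.map _
    (measurable_snd.prodMk ((γ.measurable_act (t + 1)).comp (measurable_nextInfo t)))

/-- The law of the state-action process `(X_t, U_t)_{t ≥ 0}` started at `X_0 = x₀` under the
policy `γ`. -/
def law (m : MDP S U) (γ : Policy S U) (x₀ : S) : Measure (ℕ → S × U) :=
  Kernel.trajMeasure (X := fun _ => S × U)
    (Measure.dirac (x₀, γ.act 0 (fun _ => x₀, Fin.elim0))) (m.step γ)

/-- The infinite-horizon discounted expected cost `E[∑ β^t c(X_t, U_t)]`. -/
def discountedCost (m : MDP S U) (β : ℝ) (γ : Policy S U) (x₀ : S) : ℝ :=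
  ∫ ω, ∑' t : ℕ, β ^ t * m.cost (ω t).1 (ω t).2 ∂(m.law γ x₀)

/-- The optimal value function: the infimum of the discounted cost over all admissible
policies. -/
def optimalValue (m : MDP S U) (β : ℝ) (x₀ : S) : ℝ :=
  ⨅ γ : Policy S U, m.discountedCost β γ x₀

end MDP

/-- The first order Wasserstein distance: the infimum of `E[d(X, Y)]` over all couplings. -/
def wasserstein1 {X : Type*} [MetricSpace X] [MeasurableSpace X] (μ ν : Measure X) : ℝ≥0∞ :=
  ⨅ π : {π : Measure (X × X) // π.map Prod.fst = μ ∧ π.map Prod.snd = ν},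
    ∫⁻ p, edist p.1 p.2 ∂(π : Measure (X × X))

/-- The data of a finite quantization of the state space `X`: disjoint Borel bins
`B_1, …, B_M` covering `X`, representative states `y_i ∈ B_i`, and a weighting probability
measure `π*` giving positive mass to each bin. -/
structure Quantization (X : Type*) [MeasurableSpace X] (M : ℕ) where
  bin : Fin M → Set X
  measurableSet_bin : ∀ i, MeasurableSet (bin i)
  disjoint_bin : Pairwise fun i j => Disjoint (bin i) (bin j)
  iUnion_bin : ⋃ i, bin i = Set.univ
  rep : Fin M → X
  rep_mem : ∀ i, rep i ∈ bin i
  weight : Measure X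
  isProb_weight : IsProbabilityMeasure weight
  weight_pos : ∀ i, 0 < weight (bin i)

namespace Quantization

variable {X : Type*} [MeasurableSpace X] {M : ℕ}

theorem exists_mem_bin (Q : Quantization X M) (x : X) : ∃ i, x ∈ Q.bin i := by
  have : x ∈ ⋃ i, Q.bin i := by simp [Q.iUnion_bin]
  simpa using this

/-- The index of the bin that contains `x`. -/
def index (Q : Quantization X M) (x : X) : Fin M := (Q.exists_mem_bin x).choose

theorem index_spec (Q : Quantization X M) (x : X) : x ∈ Q.bin (Q.index x) :=
  (Q.exists_mem_bin x).choose_spec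

/-- The normalized weight measure on the `i`-th bin. -/
def normalized (Q : Quantization X M) (i : Fin M) : Measure X := cond Q.weight (Q.bin i)

theorem isProb_normalized (Q : Quantization X M) (i : Fin M) :
    IsProbabilityMeasure (Q.normalized i) :=
  haveI := Q.isProb_weight
  cond_isProbabilityMeasure (Q.weight_pos i).ne'

/-- The largest bin diameter. -/
def maxDiam {X : Type*} [MetricSpace X] [MeasurableSpace X] {M : ℕ} (Q : Quantization X M) : ℝ :=
  ⨆ i : Fin M, Metric.diam (Q.bin i)

variable {U : Type*} [MeasurableSpace U]

/-- `P*(y_j | y_i, u)`: the integral of `T(B_j | x, u)` over the bin `B_i` with respect to the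
normalized weight measure. -/
def finiteProb (Q : Quantization X M) (m : MDP X U) (i : Fin M) (u : U) (j : Fin M) : ℝ≥0∞ :=
  ∫⁻ x in Q.bin i, m.trans (x, u) (Q.bin j) ∂(Q.normalized i)

/-- `C*(y_i, u)`: the integral of `c(x, u)` over the bin `B_i` with respect to the normalized
weight measure. -/
def finiteCost (Q : Quantization X M) (m : MDP X U) (i : Fin M) (u : U) : ℝ :=
  ∫ x in Q.bin i, m.cost x u ∂(Q.normalized i)

theorem sum_finiteProb (Q : Quantization X M) (m : MDP X U) (i : Fin M) (u : U) :
    ∑ j, Q.finiteProb m i u j = 1 := by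
  have := m.isMarkov_trans
  have := Q.isProb_normalized i
  have hmeas : ∀ j, Measurable fun x => m.trans (x, u) (Q.bin j) := fun j =>
    (Kernel.measurable_coe m.trans (Q.measurableSet_bin j)).comp (by fun_prop)
  have hone : ∀ x, ∑ j, m.trans (x, u) (Q.bin j) = 1 := fun x => by
    rw [← tsum_fintype (L := .unconditional _),
      ← measure_iUnion Q.disjoint_bin Q.measurableSet_bin,
      Q.iUnion_bin, measure_univ]
  have hr : (Q.normalized i).restrict (Q.bin i) = Q.normalized i := by
    unfold normalized ProbabilityTheory.cond
    rw [Measure.restrict_smul, Measure.restrict_restrict (Q.measurableSet_bin i), Set.inter_self]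
  unfold finiteProb
  rw [← lintegral_finsetSum _ fun j _ => hmeas j, hr]
  simp [hone]

/-- The finite-state model. The state `i : Fin M` stands for the representative state `y_i`. -/
def finiteModel [Finite U] [MeasurableSingletonClass U] (Q : Quantization X M) (m : MDP X U) :
    MDP (Fin M) U where
  cost := Q.finiteCost m
  measurable_cost := measurable_of_countable _
  bounded_cost := by
    obtain ⟨K, hK⟩ := (Set.finite_range
      fun p : Fin M × U => |Q.finiteCost m p.1 p.2|).bddAbove
    exact ⟨K, fun i u => hK ⟨(i, u), rfl⟩⟩
  trans := Kernel.ofFunOfCountable fun p =>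
    ∑ j, Q.finiteProb m p.1 p.2 j • Measure.dirac j
  isMarkov_trans := ⟨fun p => ⟨by
    change (∑ j, Q.finiteProb m p.1 p.2 j • Measure.dirac j : Measure (Fin M)) Set.univ = 1
    simpa using Q.sum_finiteProb m p.1 p.2⟩⟩

/-- The optimal value function of the finite-state model, extended to `X` by making it constant
on each bin. -/
def approxValue [Finite U] [MeasurableSingletonClass U] (Q : Quantization X M) (m : MDP X U)
    (β : ℝ) (x : X) : ℝ :=
  (Q.finiteModel m).optimalValue β (Q.index x)

end Quantization

end

/-!
Both value functions are fixed points of Bellman operators, and the bound comes from comparing the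
two fixed-point equations.

*Verification.* For a bounded measurable `V`, the cost of a policy started at `x₀` equals `V x₀`
plus the discounted sum of the expected gaps `c(X_t, U_t) + β E[V(X_{t+1}) | X_t, U_t] - V(X_t)`
(`MDP.discountedCost_eq_add_tsum`). If `V` is a fixed point of the Bellman operator the gaps are
nonnegative, and they vanish under a measurable greedy policy, so `V` is the infimum of the cost
over all history-dependent policies (`MDP.optimalValue_eq_of_bellman_eq`).

*Regularity.* By the coupling form of `W₁`, the Bellman operator maps `K`-Lipschitz functions to
`(αc + β αT K)`-Lipschitz ones. The value `K = αc / (1 - β αT)` is preserved, so Banach's theorem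
on the closed set of `K`-Lipschitz functions gives a `K`-Lipschitz fixed point, which is `J*`
(`MDP.optimalValue_lipschitz`).

*Comparison.* A one-step value of the finite model is the average over a bin of the one-step
values of the original model, with the terminal function made constant on bins
(`Quantization.qValue_finiteModel`). With terminal function `Ĵ`, replacing it by `J*` costs `β sup |Ĵ - J*|`, and
moving inside the bin costs `K L̄`. Hence `sup |Ĵ - J*| ≤ K L̄ + β sup |Ĵ - J*|`, which is the
claim after division by `1 - β`.
-/

/-! ### Markov policies and integrals of bounded functions -/

/-- The stationary Markov policy `U_t = f(X_t)`. -/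
def Policy.markov {S U : Type*} [MeasurableSpace S] [MeasurableSpace U] (f : S → U)
    (hf : Measurable f) : Policy S U where
  act t I := f (I.1 (Fin.last t))
  measurable_act _ := hf.comp ((measurable_pi_apply _).comp measurable_fst)

theorem integrable_of_abs_le {α : Type*} [MeasurableSpace α] {μ : Measure α} [IsFiniteMeasure μ]
    {f : α → ℝ} (hf : Measurable f) {K : ℝ} (hK : ∀ x, |f x| ≤ K) : Integrable f μ :=
  Integrable.of_bound hf.aestronglyMeasurable K (ae_of_all _ hK)

theorem abs_integral_le_of_abs_le {α : Type*} [MeasurableSpace α] {μ : Measure α}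
    [IsProbabilityMeasure μ] {f : α → ℝ} {K : ℝ} (hK : ∀ x, |f x| ≤ K) : |∫ x, f x ∂μ| ≤ K := by
  simpa using norm_integral_le_of_norm_le_const (μ := μ) (f := f) (ae_of_all _ hK)

namespace MDP

variable {S U : Type*} [MeasurableSpace S] [MeasurableSpace U]

/-! ### One-step values and the Bellman operator -/

/-- The value of choosing action `u` in state `x` and receiving `f` at the next state:
`c(x, u) + β ∫ f dT(· | x, u)`. -/
noncomputable def qValue (m : MDP S U) (β : ℝ) (f : S → ℝ) (x : S) (u : U) : ℝ :=
  m.cost x u + β * ∫ y, f y ∂m.trans (x, u)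

/-- The Bellman operator `f ↦ min_u (c(·, u) + β ∫ f dT(· | ·, u))`, with the minimum written as
an infimum. -/
noncomputable def bellman (m : MDP S U) (β : ℝ) (f : S → ℝ) (x : S) : ℝ :=
  ⨅ u, m.qValue β f x u

theorem measurable_qValue (m : MDP S U) (β : ℝ) {f : S → ℝ} (hf : Measurable f) :
    Measurable (Function.uncurry (m.qValue β f)) := by
  have := m.isMarkov_trans
  have h : Measurable fun p : S × U => ∫ y, f y ∂m.trans p :=
    (hf.stronglyMeasurable.integral_kernel (κ := m.trans)).measurable
  exact m.measurable_cost.add (h.const_mul β)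

theorem exists_abs_qValue_le (m : MDP S U) (β : ℝ) {f : S → ℝ} {K : ℝ} (hK : ∀ x, |f x| ≤ K) :
    ∃ C, ∀ x u, |m.qValue β f x u| ≤ C := by
  have := m.isMarkov_trans
  obtain ⟨C, hC⟩ := m.bounded_cost
  refine ⟨C + |β| * K, fun x u => (abs_add_le _ _).trans (add_le_add (hC x u) ?_)⟩
  rw [abs_mul]
  exact mul_le_mul_of_nonneg_left (abs_integral_le_of_abs_le hK) (abs_nonneg _)

/-! ### The law of the state-action process -/

instance isProbabilityMeasure_law (m : MDP S U) (γ : Policy S U) (x₀ : S) :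
    IsProbabilityMeasure (m.law γ x₀) := by
  unfold law; infer_instance

theorem integral_step (m : MDP S U) (γ : Policy S U) (t : ℕ) (h : Finset.Iic t → S × U)
    {g : S × U → ℝ} (hg : Measurable g) :
    ∫ z, g z ∂m.step γ t h =
      ∫ y, g (y, γ.act (t + 1) (nextInfo t (h, y)))
        ∂m.trans (h ⟨t, Finset.mem_Iic.2 le_rfl⟩) := by
  have hφ : Measurable fun p : (Finset.Iic t → S × U) × S =>
      (p.2, γ.act (t + 1) (nextInfo t p)) :=
    measurable_snd.prodMk ((γ.measurable_act (t + 1)).comp (measurable_nextInfo t))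
  have hgφ : Measurable fun p : (Finset.Iic t → S × U) × S =>
      g (p.2, γ.act (t + 1) (nextInfo t p)) := hg.comp hφ
  rw [step, Kernel.map_apply _ hφ, integral_map hφ.aemeasurable hg.aestronglyMeasurable,
    Kernel.prod_apply, Kernel.id_apply, Measure.dirac_prod,
    integral_map (by fun_prop) hgφ.aestronglyMeasurable]
  rfl

/-- One-step transition identity: given the past, the next state is drawn from the transition
kernel and the next action is the one prescribed by the policy. -/
theorem integral_law_succ (m : MDP S U) (γ : Policy S U) (x₀ : S) (t : ℕ)
    {g : S × U → ℝ} (hg : Measurable g) {K : ℝ} (hK : ∀ z, |g z| ≤ K) :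
    ∫ ω, g (ω (t + 1)) ∂m.law γ x₀ =
      ∫ ω, ∫ y, g (y, γ.act (t + 1) (nextInfo t (fun i => ω i, y))) ∂m.trans (ω t)
        ∂m.law γ x₀ := by
  have key : (m.law γ x₀).map (Preorder.frestrictLe (π := fun _ => S × U) t) ⊗ₘ m.step γ t =
      (m.law γ x₀).map
        fun ω => (Preorder.frestrictLe (π := fun _ => S × U) t ω, ω (t + 1)) :=
    Kernel.map_frestrictLe_trajMeasure_compProd_eq_map_trajMeasure
  have hint : Measurable fun p : (Finset.Iic t → S × U) × (S × U) => g p.2 :=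
    hg.comp measurable_snd
  have hprob : IsProbabilityMeasure
      ((m.law γ x₀).map (Preorder.frestrictLe (π := fun _ => S × U) t)) :=
    Measure.isProbabilityMeasure_map (by fun_prop)
  have h1 : ∫ ω, g (ω (t + 1)) ∂m.law γ x₀ = ∫ p, g p.2 ∂((m.law γ x₀).map
        fun ω => (Preorder.frestrictLe (π := fun _ => S × U) t ω, ω (t + 1))) := by
    rw [integral_map (by fun_prop) hint.aestronglyMeasurable]
  have hsm : StronglyMeasurable fun h => ∫ z, g z ∂m.step γ t h :=
    hg.stronglyMeasurable.integral_kernel (κ := m.step γ t)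
  rw [h1, ← key, Measure.integral_compProd (integrable_of_abs_le hint fun p => hK p.2),
    integral_map (by fun_prop) hsm.aestronglyMeasurable]
  refine integral_congr_ae (ae_of_all _ fun ω => ?_)
  exact m.integral_step γ t _ hg

theorem integral_law_zero (m : MDP S U) (γ : Policy S U) (x₀ : S)
    {g : S × U → ℝ} (hg : Measurable g) :
    ∫ ω, g (ω 0) ∂m.law γ x₀ = g (x₀, γ.act 0 (fun _ => x₀, Fin.elim0)) := by
  have h0 : (m.law γ x₀).map (Preorder.frestrictLe (π := fun _ => S × U) 0) =
      (Measure.dirac (x₀, γ.act 0 (fun _ => x₀, Fin.elim0))).map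
        (MeasurableEquiv.piUnique (fun _ : Finset.Iic 0 => S × U)).symm := by
    unfold law Kernel.trajMeasure
    rw [Measure.map_comp _ _ (by fun_prop), Kernel.traj_map_frestrictLe, Kernel.partialTraj_self]
    exact Measure.id_comp
  have hg' : Measurable fun h : Finset.Iic 0 → S × U => g (h ⟨0, Finset.mem_Iic.2 le_rfl⟩) :=
    hg.comp (measurable_pi_apply _)
  have h1 : ∫ ω, g (ω 0) ∂m.law γ x₀ = ∫ h, g (h ⟨0, Finset.mem_Iic.2 le_rfl⟩)
      ∂((m.law γ x₀).map (Preorder.frestrictLe (π := fun _ => S × U) 0)) := by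
    rw [integral_map (by fun_prop) hg'.aestronglyMeasurable]
    rfl
  rw [h1, h0, integral_map (by fun_prop) hg'.aestronglyMeasurable]
  exact integral_dirac' _ _ (hg'.comp (MeasurableEquiv.measurable _)).stronglyMeasurable

/-- Under a stationary Markov policy the action at each time is the prescribed function of the
state. -/
theorem integral_law_markov (m : MDP S U) {f : S → U} (hf : Measurable f) (x₀ : S) (t : ℕ)
    {g : S × U → ℝ} (hg : Measurable g) {K : ℝ} (hK : ∀ z, |g z| ≤ K) :
    ∫ ω, g (ω t) ∂m.law (Policy.markov f hf) x₀ =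
      ∫ ω, g ((ω t).1, f (ω t).1) ∂m.law (Policy.markov f hf) x₀ := by
  have hg' : Measurable fun z : S × U => g (z.1, f z.1) := by fun_prop
  cases t with
  | zero => rw [integral_law_zero m _ x₀ hg, integral_law_zero m _ x₀ hg']; rfl
  | succ t =>
    rw [integral_law_succ m _ x₀ t hg hK,
      integral_law_succ m _ x₀ t hg' fun z => hK _]
    refine integral_congr_ae (ae_of_all _ fun ω => integral_congr_ae (ae_of_all _ fun y => ?_))
    simp [Policy.markov, nextInfo]

/-! ### Performance difference and verification -/

theorem discountedCost_eq_tsum (m : MDP S U) {β : ℝ} (hβ0 : 0 ≤ β) (hβ1 : β < 1)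
    (γ : Policy S U) (x₀ : S) :
    m.discountedCost β γ x₀ =
      ∑' t : ℕ, β ^ t * ∫ ω, m.cost (ω t).1 (ω t).2 ∂m.law γ x₀ := by
  obtain ⟨C, hC⟩ := m.bounded_cost
  have hmeas : ∀ t : ℕ, Measurable fun ω : ℕ → S × U => m.cost (ω t).1 (ω t).2 := fun t =>
    m.measurable_cost.comp (measurable_pi_apply t)
  have hint : ∀ t : ℕ, Integrable (fun ω : ℕ → S × U => β ^ t * m.cost (ω t).1 (ω t).2)
      (m.law γ x₀) := fun t => (integrable_of_abs_le (hmeas t) fun ω => hC _ _).const_mul _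
  unfold discountedCost
  rw [← integral_tsum_of_summable_integral_norm hint]
  · simp_rw [integral_const_mul]
  · refine Summable.of_nonneg_of_le (fun t => integral_nonneg fun ω => norm_nonneg _) (fun t => ?_)
      ((summable_geometric_of_lt_one hβ0 hβ1).mul_right C)
    refine (le_abs_self _).trans (abs_integral_le_of_abs_le fun ω => ?_)
    rw [abs_norm, norm_mul, Real.norm_of_nonneg (pow_nonneg hβ0 t)]
    exact mul_le_mul_of_nonneg_left (hC _ _) (pow_nonneg hβ0 t)

/-- Performance difference formula: the discounted cost of a policy exceeds `V(x₀)` by the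
discounted sum of the expected Bellman gaps `c(X_t, U_t) + β E[V(X_{t+1}) | X_t, U_t] - V(X_t)`. -/
theorem discountedCost_eq_add_tsum (m : MDP S U) {β : ℝ} (hβ0 : 0 ≤ β) (hβ1 : β < 1)
    (γ : Policy S U) (x₀ : S) {V : S → ℝ} (hV : Measurable V) {K : ℝ} (hK : ∀ x, |V x| ≤ K) :
    m.discountedCost β γ x₀ = V x₀ + ∑' t : ℕ, β ^ t *
      ∫ ω, (m.qValue β V (ω t).1 (ω t).2 - V (ω t).1) ∂m.law γ x₀ := by
  have := m.isMarkov_trans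
  obtain ⟨C, hC⟩ := m.bounded_cost
  have hsum : ∀ {a : ℕ → ℝ} {D : ℝ}, (∀ t, |a t| ≤ D) → Summable fun t => β ^ t * a t := by
    intro a D ha
    refine Summable.of_norm_bounded ((summable_geometric_of_lt_one hβ0 hβ1).mul_right D)
      fun t => ?_
    rw [norm_mul, Real.norm_of_nonneg (pow_nonneg hβ0 t)]
    exact mul_le_mul_of_nonneg_left (ha t) (pow_nonneg hβ0 t)
  set c : ℕ → ℝ := fun t => ∫ ω, m.cost (ω t).1 (ω t).2 ∂m.law γ x₀ with hc
  set v : ℕ → ℝ := fun t => ∫ ω, V (ω t).1 ∂m.law γ x₀ with hv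
  have hcs : Summable fun t => β ^ t * c t :=
    hsum fun t => abs_integral_le_of_abs_le fun ω => hC _ _
  have hvs : Summable fun t => β ^ t * v t :=
    hsum fun t => abs_integral_le_of_abs_le fun ω => hK _
  have hv0 : v 0 = V x₀ := m.integral_law_zero γ x₀ (hV.comp measurable_fst)
  have hgap : ∀ t, ∫ ω, (m.qValue β V (ω t).1 (ω t).2 - V (ω t).1) ∂m.law γ x₀ =
      c t + β * v (t + 1) - v t := by
    intro t
    have h1 : v (t + 1) = ∫ ω, ∫ y, V y ∂m.trans (ω t) ∂m.law γ x₀ :=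
      m.integral_law_succ γ x₀ t (hV.comp measurable_fst) fun z => hK z.1
    have hm : Measurable fun p : S × U => ∫ y, V y ∂m.trans p :=
      (hV.stronglyMeasurable.integral_kernel (κ := m.trans)).measurable
    have i1 : Integrable (fun ω : ℕ → S × U => m.cost (ω t).1 (ω t).2) (m.law γ x₀) :=
      integrable_of_abs_le (m.measurable_cost.comp (measurable_pi_apply t)) fun ω => hC _ _
    have i2 : Integrable (fun ω : ℕ → S × U => ∫ y, V y ∂m.trans (ω t)) (m.law γ x₀) :=
      integrable_of_abs_le (hm.comp (measurable_pi_apply t))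
        fun ω => abs_integral_le_of_abs_le hK
    have i3 : Integrable (fun ω : ℕ → S × U => V (ω t).1) (m.law γ x₀) :=
      integrable_of_abs_le (hV.comp (measurable_fst.comp (measurable_pi_apply t))) fun ω => hK _
    rw [h1, ← integral_const_mul, ← integral_add i1 (i2.const_mul β)]
    exact integral_sub (i1.add (i2.const_mul β)) i3
  have hvs1 : Summable fun t => β ^ (t + 1) * v (t + 1) := (summable_nat_add_iff 1).2 hvs
  -- With `β ^ t` in front, the terms `β v (t + 1) - v t` telescope to `-v 0`.
  have htel := hvs.tsum_eq_zero_add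
  rw [m.discountedCost_eq_tsum hβ0 hβ1]
  have hterm : ∀ t, β ^ t * ∫ ω, (m.qValue β V (ω t).1 (ω t).2 - V (ω t).1) ∂m.law γ x₀ =
      β ^ t * c t + β ^ (t + 1) * v (t + 1) - β ^ t * v t := by
    intro t; rw [hgap]; ring
  simp_rw [hterm]
  rw [(hcs.add hvs1).tsum_sub hvs, hcs.tsum_add hvs1]
  rw [pow_zero, one_mul, hv0] at htel
  linarith

/-- A measurable greedy selector: since there are finitely many actions, the first minimizing one
in an enumeration depends measurably on the state. -/
theorem exists_measurable_greedy [Finite U] [Nonempty U] (m : MDP S U) (β : ℝ)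
    {V : S → ℝ} (hV : Measurable V) :
    ∃ f : S → U, Measurable f ∧ ∀ x, m.qValue β V x (f x) = m.bellman β V x := by
  classical
  obtain ⟨e, he⟩ := exists_surjective_nat U
  have hq : ∀ u, Measurable fun x => m.qValue β V x u := fun u =>
    (m.measurable_qValue β hV).comp measurable_prodMk_right
  have hex : ∀ x, ∃ n, m.qValue β V x (e n) = m.bellman β V x := by
    intro x
    obtain ⟨u, hu⟩ := exists_eq_ciInf_of_finite (f := m.qValue β V x)
    obtain ⟨n, rfl⟩ := he u
    exact ⟨n, hu⟩
  refine ⟨fun x => e (Nat.find (hex x)), (measurable_from_nat (f := e)).comp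
    (measurable_find hex fun n => measurableSet_eq_fun (hq _) (.iInf hq)),
    fun x => Nat.find_spec (hex x)⟩

/-- Verification theorem: a bounded measurable fixed point of the Bellman operator is the optimal
value function. -/
theorem optimalValue_eq_of_bellman_eq [Finite U] [Nonempty U] (m : MDP S U) {β : ℝ}
    (hβ0 : 0 ≤ β) (hβ1 : β < 1) {V : S → ℝ} (hV : Measurable V) {K : ℝ} (hK : ∀ x, |V x| ≤ K)
    (hfix : ∀ x, m.bellman β V x = V x) (x₀ : S) : m.optimalValue β x₀ = V x₀ := by
  obtain ⟨f, hf, hfmin⟩ := m.exists_measurable_greedy β hV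
  have hle : ∀ x u, V x ≤ m.qValue β V x u := fun x u =>
    (hfix x).symm.trans_le (ciInf_le (Set.finite_range _).bddBelow u)
  have hlow : ∀ γ : Policy S U, V x₀ ≤ m.discountedCost β γ x₀ := by
    intro γ
    rw [m.discountedCost_eq_add_tsum hβ0 hβ1 γ x₀ hV hK]
    exact le_add_of_nonneg_right (tsum_nonneg fun t => mul_nonneg (pow_nonneg hβ0 t)
      (integral_nonneg fun ω => sub_nonneg.2 (hle _ _)))
  have hopt : m.discountedCost β (Policy.markov f hf) x₀ = V x₀ := by
    obtain ⟨C, hC⟩ := m.exists_abs_qValue_le β hK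
    rw [m.discountedCost_eq_add_tsum hβ0 hβ1 _ x₀ hV hK]
    have hgap : ∀ t : ℕ, ∫ ω, (m.qValue β V (ω t).1 (ω t).2 - V (ω t).1)
        ∂m.law (Policy.markov f hf) x₀ = 0 := by
      intro t
      rw [m.integral_law_markov hf x₀ t
        (g := fun z => m.qValue β V z.1 z.2 - V z.1)
        ((m.measurable_qValue β hV).sub (hV.comp measurable_fst))
        (K := C + K) fun z => (abs_sub _ _).trans (add_le_add (hC _ _) (hK _))]
      simp [hfmin, hfix]
    simp [hgap]
  have : Nonempty (Policy S U) := ⟨Policy.markov f hf⟩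
  exact le_antisymm ((ciInf_le ⟨V x₀, Set.forall_mem_range.2 hlow⟩ _).trans_eq hopt)
    (le_ciInf hlow)

end MDP

/-! ### Minima, and integrals of Lipschitz functions -/

theorem abs_ciInf_sub_ciInf_le {ι : Type*} [Finite ι] [Nonempty ι] {a b : ι → ℝ} {d : ℝ}
    (h : ∀ i, |a i - b i| ≤ d) : |(⨅ i, a i) - ⨅ i, b i| ≤ d := by
  obtain ⟨i, hi⟩ := exists_eq_ciInf_of_finite (f := a)
  obtain ⟨j, hj⟩ := exists_eq_ciInf_of_finite (f := b)
  have ha : ⨅ i, a i ≤ a j := ciInf_le (Set.finite_range a).bddBelow j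
  have hb : ⨅ i, b i ≤ b i := ciInf_le (Set.finite_range b).bddBelow i
  have h1 := abs_le.1 (h i)
  have h2 := abs_le.1 (h j)
  rw [abs_le]
  constructor <;> linarith

/-- The easy half of Kantorovich duality: integrals of a `K`-Lipschitz function against two
measures differ by at most `K` times their Wasserstein distance. -/
theorem abs_integral_sub_integral_le_of_wasserstein1_le {X : Type*} [MetricSpace X]
    [SecondCountableTopology X] [MeasurableSpace X] [BorelSpace X] {μ ν : Measure X}
    [IsProbabilityMeasure μ] [IsProbabilityMeasure ν] {f : X → ℝ} (hf : Measurable f)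
    {C : ℝ} (hC : ∀ x, |f x| ≤ C) {K r : ℝ} (hK : 0 < K) (hr : 0 ≤ r)
    (hlip : ∀ x y, |f x - f y| ≤ K * dist x y) (hW : wasserstein1 μ ν ≤ ENNReal.ofReal r) :
    |∫ x, f x ∂μ - ∫ x, f x ∂ν| ≤ K * r := by
  have key : ENNReal.ofReal |∫ x, f x ∂μ - ∫ x, f x ∂ν| ≤
      ENNReal.ofReal K * wasserstein1 μ ν := by
    -- It suffices to compare along an arbitrary coupling.
    unfold wasserstein1
    rw [ENNReal.mul_iInf_of_ne (by simpa using hK) ENNReal.ofReal_ne_top]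
    refine le_iInf fun ⟨π, h1, h2⟩ => ?_
    have hπ : IsProbabilityMeasure π := by
      constructor
      rw [← Set.preimage_univ (f := Prod.fst), ← Measure.map_apply measurable_fst .univ, h1,
        measure_univ]
    have e1 : ∫ x, f x ∂μ = ∫ p, f p.1 ∂π := by
      rw [← h1, integral_map (by fun_prop) hf.aestronglyMeasurable]
    have e2 : ∫ x, f x ∂ν = ∫ p, f p.2 ∂π := by
      rw [← h2, integral_map (by fun_prop) hf.aestronglyMeasurable]
    have i1 : Integrable (fun p : X × X => f p.1) π :=
      integrable_of_abs_le (hf.comp measurable_fst) fun _ => hC _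
    have i2 : Integrable (fun p : X × X => f p.2) π :=
      integrable_of_abs_le (hf.comp measurable_snd) fun _ => hC _
    rw [e1, e2, ← integral_sub i1 i2, ← Real.enorm_eq_ofReal_abs,
      ← lintegral_const_mul _ measurable_edist]
    refine (enorm_integral_le_lintegral_enorm _).trans (lintegral_mono fun p => ?_)
    rw [edist_dist, ← ENNReal.ofReal_mul hK.le, Real.enorm_eq_ofReal_abs]
    exact ENNReal.ofReal_le_ofReal (hlip _ _)
  have h := key.trans (mul_le_mul_right hW _)
  rw [← ENNReal.ofReal_mul hK.le] at h
  exact (ENNReal.ofReal_le_ofReal_iff (by positivity)).1 h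

namespace MDP

variable {S U : Type*} [MeasurableSpace S] [MeasurableSpace U]

/-! ### Fixed points of the Bellman operator -/

/-- The Bellman operator contracts sup-norm distances by the factor `β`. -/
theorem abs_bellman_sub_le [Finite U] [Nonempty U] (m : MDP S U) {β : ℝ} (hβ0 : 0 ≤ β)
    {f g : S → ℝ} (hf : Measurable f) (hg : Measurable g) {C D d : ℝ}
    (hC : ∀ x, |f x| ≤ C) (hD : ∀ x, |g x| ≤ D) (hd : ∀ x, |f x - g x| ≤ d) (x : S) :
    |m.bellman β f x - m.bellman β g x| ≤ β * d := by
  have := m.isMarkov_trans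
  refine abs_ciInf_sub_ciInf_le fun u => ?_
  have : m.qValue β f x u - m.qValue β g x u = β * ∫ y, (f y - g y) ∂m.trans (x, u) := by
    rw [integral_sub (integrable_of_abs_le hf hC) (integrable_of_abs_le hg hD)]
    unfold qValue; ring
  rw [this, abs_mul, abs_of_nonneg hβ0]
  exact mul_le_mul_of_nonneg_left (abs_integral_le_of_abs_le hd) hβ0

/-- On a compact state space, the Bellman operator has a fixed point in every nonempty closed set
of continuous functions that it maps into itself. -/
theorem exists_bellman_fixedPoint [TopologicalSpace S] [CompactSpace S] [OpensMeasurableSpace S]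
    [Finite U] [Nonempty U] (m : MDP S U) {β : ℝ} (hβ0 : 0 ≤ β) (hβ1 : β < 1)
    {A : Set C(S, ℝ)} (hA : IsClosed A) (hne : A.Nonempty)
    (hmaps : ∀ f ∈ A, ∃ g ∈ A, ∀ x, g x = m.bellman β f x) :
    ∃ V ∈ A, ∀ x, m.bellman β V x = V x := by
  choose! F hFA hF using hmaps
  have := hA.completeSpace_coe
  have := hne.to_subtype
  let Φ : A → A := fun f => ⟨F f, hFA f f.2⟩
  have hΦ : ContractingWith ⟨β, hβ0⟩ Φ := by
    refine ⟨hβ1, LipschitzWith.of_dist_le_mul fun f g => ?_⟩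
    refine (ContinuousMap.dist_le (mul_nonneg hβ0 dist_nonneg)).2 fun x => ?_
    rw [Real.dist_eq]
    change |F f x - F g x| ≤ _
    rw [hF f f.2, hF g g.2]
    exact m.abs_bellman_sub_le hβ0 f.1.continuous.measurable g.1.continuous.measurable
      (fun x => f.1.norm_coe_le_norm x) (fun x => g.1.norm_coe_le_norm x)
      (fun x => f.1.dist_apply_le_dist x) x
  let V : A := ContractingWith.fixedPoint Φ hΦ
  have hV : Φ V = V := hΦ.fixedPoint_isFixedPt
  refine ⟨V, V.2, fun x => ?_⟩
  rw [← hF _ V.2]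
  exact congrArg (fun f : A => (f : C(S, ℝ)) x) hV

/-- If the transition kernel is `αT`-Lipschitz for `W₁` and `f` is `K`-Lipschitz, then
`x ↦ c(x, u) + β ∫ f dT(· | x, u)` is `(αc + β αT K)`-Lipschitz. -/
theorem abs_qValue_sub_le {X : Type*} [MetricSpace X] [SecondCountableTopology X]
    [MeasurableSpace X] [BorelSpace X] (m : MDP X U) {β αc αT K : ℝ} (hβ0 : 0 ≤ β)
    (hαT : 0 ≤ αT)
    (hcost : ∀ x x' : X, ∀ u : U, |m.cost x u - m.cost x' u| ≤ αc * dist x x')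
    (htrans : ∀ x x' : X, ∀ u : U,
      wasserstein1 (m.trans (x, u)) (m.trans (x', u)) ≤ ENNReal.ofReal (αT * dist x x'))
    {f : X → ℝ} (hf : Measurable f) {C : ℝ} (hC : ∀ x, |f x| ≤ C) (hK : 0 < K)
    (hlip : ∀ x y, |f x - f y| ≤ K * dist x y) (x x' : X) (u : U) :
    |m.qValue β f x u - m.qValue β f x' u| ≤ (αc + β * αT * K) * dist x x' := by
  have := m.isMarkov_trans
  have h := abs_integral_sub_integral_le_of_wasserstein1_le hf hC hK
    (mul_nonneg hαT dist_nonneg) hlip (htrans x x' u)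
  have e : m.qValue β f x u - m.qValue β f x' u = (m.cost x u - m.cost x' u) +
      β * (∫ y, f y ∂m.trans (x, u) - ∫ y, f y ∂m.trans (x', u)) := by
    unfold qValue; ring
  rw [e]
  refine (abs_add_le _ _).trans ((add_le_add (hcost x x' u) ?_).trans_eq
    (b := αc * dist x x' + β * (K * (αT * dist x x'))) (by ring))
  rw [abs_mul, abs_of_nonneg hβ0]
  exact mul_le_mul_of_nonneg_left h hβ0

/-- The constant `αc / (1 - β αT)` is the fixed point of `K ↦ αc + β αT K`, so the Bellman operator
preserves Lipschitz continuity with this constant, and so does its fixed point, the optimal value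
function. -/
theorem optimalValue_lipschitz {X : Type*} [MetricSpace X] [CompactSpace X]
    [MeasurableSpace X] [BorelSpace X] [Finite U] [Nonempty U] (m : MDP X U) {β αc αT : ℝ}
    (hβ0 : 0 ≤ β) (hβ1 : β < 1) (hαc : 0 < αc) (hαT : 0 ≤ αT) (hβαT : β * αT < 1)
    (hcost : ∀ x x' : X, ∀ u : U, |m.cost x u - m.cost x' u| ≤ αc * dist x x')
    (htrans : ∀ x x' : X, ∀ u : U,
      wasserstein1 (m.trans (x, u)) (m.trans (x', u)) ≤ ENNReal.ofReal (αT * dist x x')) :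
    Continuous (m.optimalValue β) ∧
      (∀ x y, |m.optimalValue β x - m.optimalValue β y| ≤ αc / (1 - β * αT) * dist x y) ∧
      ∀ x, m.bellman β (m.optimalValue β) x = m.optimalValue β x := by
  set K := αc / (1 - β * αT) with hKdef
  have hK : 0 < K := div_pos hαc (by linarith)
  have hKfix : αc + β * αT * K = K := by
    have : K * (1 - β * αT) = αc := div_mul_cancel₀ _ (by linarith)
    linarith
  let A : Set C(X, ℝ) := {f | ∀ x y, |f x - f y| ≤ K * dist x y}
  have hA : IsClosed A := by
    simp only [A, Set.ofPred_forall]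
    exact isClosed_iInter fun x => isClosed_iInter fun y => isClosed_le
      ((ContinuousEvalConst.continuous_eval_const x).sub (ContinuousEvalConst.continuous_eval_const y)).abs
      continuous_const
  obtain ⟨V, hVA, hV⟩ := m.exists_bellman_fixedPoint hβ0 hβ1 hA
    ⟨0, fun x y => by simpa using mul_nonneg hK.le dist_nonneg⟩ fun f hf => by
      have hlip : ∀ x y, |m.bellman β f x - m.bellman β f y| ≤ K * dist x y := fun x y =>
        abs_ciInf_sub_ciInf_le fun u => (m.abs_qValue_sub_le hβ0 hαT hcost htrans
          f.continuous.measurable (fun x => f.norm_coe_le_norm x) hK hf x y u).trans_eq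
          (by rw [hKfix])
      exact ⟨⟨m.bellman β f, (LipschitzWith.of_dist_le_mul (K := ⟨K, hK.le⟩) hlip).continuous⟩,
        hlip, fun x => rfl⟩
  have hopt : m.optimalValue β = V := funext fun x =>
    m.optimalValue_eq_of_bellman_eq hβ0 hβ1 V.continuous.measurable
      (fun x => V.norm_coe_le_norm x) hV x
  rw [hopt]
  exact ⟨V.continuous, hVA, hV⟩

/-- On a finite state space the optimal value function satisfies the Bellman equation. -/
theorem bellman_optimalValue_of_finite {n : ℕ} [Finite U] [Nonempty U] (m : MDP (Fin n) U) {β : ℝ}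
    (hβ0 : 0 ≤ β) (hβ1 : β < 1) (i : Fin n) :
    m.bellman β (m.optimalValue β) i = m.optimalValue β i := by
  obtain ⟨V, -, hV⟩ := m.exists_bellman_fixedPoint hβ0 hβ1 isClosed_univ Set.univ_nonempty
    fun f _ => ⟨⟨m.bellman β f, continuous_of_discreteTopology⟩, trivial, fun x => rfl⟩
  have hopt : m.optimalValue β = V := funext fun x =>
    m.optimalValue_eq_of_bellman_eq hβ0 hβ1 V.continuous.measurable
      (fun x => V.norm_coe_le_norm x) hV x
  rw [hopt]
  exact hV i

end MDP

namespace Quantization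

variable {X U : Type*} [MeasurableSpace X] {M : ℕ} [MeasurableSpace U]

/-! ### The finite model -/

theorem mem_bin_iff (Q : Quantization X M) (x : X) (i : Fin M) : x ∈ Q.bin i ↔ Q.index x = i := by
  constructor
  · intro h
    by_contra hne
    exact Set.disjoint_left.1 (Q.disjoint_bin hne) (Q.index_spec x) h
  · rintro rfl
    exact Q.index_spec x

theorem measurable_index (Q : Quantization X M) : Measurable Q.index := by
  refine measurable_to_countable' fun i => ?_
  convert Q.measurableSet_bin i using 1
  ext x
  simp [mem_bin_iff]

theorem restrict_normalized (Q : Quantization X M) (i : Fin M) :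
    (Q.normalized i).restrict (Q.bin i) = Q.normalized i := by
  unfold normalized ProbabilityTheory.cond
  rw [Measure.restrict_smul, Measure.restrict_restrict (Q.measurableSet_bin i), Set.inter_self]

/-- One quantized step: the finite model averages, over the bin and with the normalized weights,
the one-step values of the original model with the terminal function made constant on bins. -/
theorem qValue_finiteModel [Finite U] [MeasurableSingletonClass U] (Q : Quantization X M)
    (m : MDP X U) (β : ℝ) (V : Fin M → ℝ) (i : Fin M) (u : U) :
    (Q.finiteModel m).qValue β V i u =
      ∫ x, m.qValue β (fun y => V (Q.index y)) x u ∂Q.normalized i := by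
  have := m.isMarkov_trans
  have := Q.isProb_normalized i
  obtain ⟨C, hC⟩ := m.bounded_cost
  have hP : ∀ j, Measurable fun x => m.trans (x, u) (Q.bin j) := fun j =>
    (Kernel.measurable_coe m.trans (Q.measurableSet_bin j)).comp (by fun_prop)
  have hint : ∀ x, ∫ y, V (Q.index y) ∂m.trans (x, u) =
      ∑ j, (m.trans (x, u) (Q.bin j)).toReal * V j := by
    intro x
    rw [← integral_map (φ := Q.index) Q.measurable_index.aemeasurable
      (measurable_of_countable V).aestronglyMeasurable]
    have := Measure.isProbabilityMeasure_map (μ := m.trans (x, u)) Q.measurable_index.aemeasurable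
    rw [integral_fintype .of_finite]
    refine Finset.sum_congr rfl fun j _ => ?_
    rw [measureReal_def, Measure.map_apply Q.measurable_index (measurableSet_singleton j),
      smul_eq_mul]
    congr 3
    ext y
    simp [mem_bin_iff]
  have hPint : ∀ j, Integrable (fun x => (m.trans (x, u) (Q.bin j)).toReal) (Q.normalized i) :=
    fun j => integrable_of_abs_le (hP j).ennreal_toReal (K := 1) fun x => by
      rw [abs_of_nonneg ENNReal.toReal_nonneg]
      exact ENNReal.toReal_le_of_le_ofReal zero_le_one (by simpa using prob_le_one)
  have hprob : ∀ j, (Q.finiteProb m i u j).toReal =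
      ∫ x, (m.trans (x, u) (Q.bin j)).toReal ∂Q.normalized i := by
    intro j
    rw [finiteProb, Q.restrict_normalized,
      integral_toReal (hP j).aemeasurable (ae_of_all _ fun x => measure_lt_top _ _)]
  have hfin : ∫ j, V j ∂(Q.finiteModel m).trans (i, u) =
      ∑ j, (Q.finiteProb m i u j).toReal * V j := by
    change ∫ j, V j ∂(∑ j, Q.finiteProb m i u j • Measure.dirac j : Measure (Fin M)) = _
    have hne : ∀ j, Q.finiteProb m i u j ≠ ∞ := fun j =>
      ((Finset.single_le_sum (f := Q.finiteProb m i u) (fun _ _ => zero_le)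
        (Finset.mem_univ j)).trans_lt (by simp [Q.sum_finiteProb])).ne
    rw [integral_finsetSum_measure fun j _ => (integrable_dirac (by simp)).smul_measure (hne j)]
    simp
  unfold MDP.qValue
  rw [hfin]
  change Q.finiteCost m i u + _ = _
  rw [finiteCost, Q.restrict_normalized]
  simp_rw [hint]
  have hc : Integrable (fun x => m.cost x u) (Q.normalized i) :=
    integrable_of_abs_le (m.measurable_cost.comp measurable_prodMk_right) fun x => hC x u
  rw [integral_add hc ((integrable_finsetSum _ fun j _ => (hPint j).mul_const (V j)).const_mul β),
    integral_const_mul, integral_finsetSum _ fun j _ => (hPint j).mul_const (V j)]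
  simp_rw [hprob, integral_mul_const]

theorem dist_le_maxDiam {X : Type*} [MetricSpace X] [CompactSpace X] [MeasurableSpace X]
    (Q : Quantization X M) {x z : X} (h : z ∈ Q.bin (Q.index x)) : dist z x ≤ Q.maxDiam :=
  (Metric.dist_le_diam_of_mem (Metric.isBounded_of_compactSpace) h (Q.index_spec x)).trans
    (le_ciSup (f := fun i => Metric.diam (Q.bin i)) (Set.finite_range _).bddAbove (Q.index x))

/-- The normalized weight measure of a bin is concentrated on it. -/
theorem ae_normalized_mem_bin (Q : Quantization X M) (i : Fin M) :
    ∀ᵐ x ∂Q.normalized i, x ∈ Q.bin i := by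
  rw [← Q.restrict_normalized i]
  exact ae_restrict_mem (Q.measurableSet_bin i)

/-- If `J` is a bounded measurable function whose one-step values differ by at most `r` between
points of a common bin, then the one-step values of the finite model started from `V` are within
`r + β d` of those of the original model started from `J`, where `d` bounds `|V - J|`. -/
theorem abs_qValue_finiteModel_sub_le [Finite U] [MeasurableSingletonClass U]
    (Q : Quantization X M) (m : MDP X U) {β : ℝ} (hβ0 : 0 ≤ β) (V : Fin M → ℝ) {J : X → ℝ}
    (hJ : Measurable J) {C : ℝ} (hC : ∀ x, |J x| ≤ C) {d r : ℝ}
    (hd : ∀ x, |V (Q.index x) - J x| ≤ d) (u : U) (x : X)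
    (hr : ∀ z ∈ Q.bin (Q.index x), |m.qValue β J z u - m.qValue β J x u| ≤ r) :
    |(Q.finiteModel m).qValue β V (Q.index x) u - m.qValue β J x u| ≤ r + β * d := by
  have := m.isMarkov_trans
  have := Q.isProb_normalized (Q.index x)
  have hVm : Measurable fun y => V (Q.index y) :=
    (measurable_of_countable V).comp Q.measurable_index
  have hVb : ∀ y, |V (Q.index y)| ≤ d + C := fun y => by
    have := abs_add_le (V (Q.index y) - J y) (J y)
    rw [sub_add_cancel] at this
    exact this.trans (add_le_add (hd y) (hC y))
  obtain ⟨B, hB⟩ := m.exists_abs_qValue_le β hVb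
  have hint : Integrable (fun z => m.qValue β (fun y => V (Q.index y)) z u)
      (Q.normalized (Q.index x)) :=
    integrable_of_abs_le ((m.measurable_qValue β hVm).comp measurable_prodMk_right) fun z => hB z u
  have e : (Q.finiteModel m).qValue β V (Q.index x) u - m.qValue β J x u =
      ∫ z, (m.qValue β (fun y => V (Q.index y)) z u - m.qValue β J x u)
        ∂Q.normalized (Q.index x) := by
    rw [integral_sub hint (integrable_const _), Q.qValue_finiteModel]
    simp
  rw [e]
  have hae : ∀ᵐ z ∂Q.normalized (Q.index x),
      ‖m.qValue β (fun y => V (Q.index y)) z u - m.qValue β J x u‖ ≤ r + β * d := by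
    filter_upwards [Q.ae_normalized_mem_bin (Q.index x)] with z hz
    have h1 : m.qValue β (fun y => V (Q.index y)) z u - m.qValue β J z u =
        β * ∫ y, (V (Q.index y) - J y) ∂m.trans (z, u) := by
      rw [integral_sub (integrable_of_abs_le hVm hVb) (integrable_of_abs_le hJ hC)]
      unfold MDP.qValue; ring
    have h2 : |m.qValue β (fun y => V (Q.index y)) z u - m.qValue β J z u| ≤ β * d := by
      rw [h1, abs_mul, abs_of_nonneg hβ0]
      exact mul_le_mul_of_nonneg_left (abs_integral_le_of_abs_le hd) hβ0
    rw [Real.norm_eq_abs, add_comm]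
    exact (abs_sub_le _ _ _).trans (add_le_add h2 (hr z hz))
  simpa using norm_integral_le_of_norm_le_const hae

end Quantization

/-! ### The approximation error -/

theorem theorem5 {X U : Type*} [MetricSpace X] [CompactSpace X] [MeasurableSpace X] [BorelSpace X]
    [Finite U] [Nonempty U] [MeasurableSpace U] [MeasurableSingletonClass U]
    (m : MDP X U) (β : ℝ) (hβ0 : 0 < β) (hβ1 : β < 1)
    (αc αT : ℝ) (hαc : 0 < αc) (hαT : 0 < αT) (hβαT : β * αT < 1)
    (hcost : ∀ x x' : X, ∀ u : U, |m.cost x u - m.cost x' u| ≤ αc * dist x x')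
    (htrans : ∀ x x' : X, ∀ u : U,
      wasserstein1 (m.trans (x, u)) (m.trans (x', u)) ≤ ENNReal.ofReal (αT * dist x x'))
    {M : ℕ} (Q : Quantization X M) :
    BddAbove (Set.range fun x₀ : X => |Q.approxValue m β x₀ - m.optimalValue β x₀|) ∧
      (⨆ x₀ : X, |Q.approxValue m β x₀ - m.optimalValue β x₀|) ≤
        αc / ((1 - β * αT) * (1 - β)) * Q.maxDiam := by
  have := Q.isProb_weight
  have : Nonempty X := nonempty_of_isProbabilityMeasure Q.weight
  obtain ⟨hJcont, hJlip, hJfix⟩ :=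
    m.optimalValue_lipschitz hβ0.le hβ1 hαc hαT.le hβαT hcost htrans
  have hVfix := (Q.finiteModel m).bellman_optimalValue_of_finite hβ0.le hβ1
  set J := m.optimalValue β
  set V := (Q.finiteModel m).optimalValue β with hVdef
  change BddAbove (Set.range fun x₀ : X => |V (Q.index x₀) - J x₀|) ∧
    (⨆ x₀ : X, |V (Q.index x₀) - J x₀|) ≤ _
  set K := αc / (1 - β * αT) with hKdef
  have hK : 0 < K := div_pos hαc (by linarith)
  have hKfix : αc + β * αT * K = K := by
    have : K * (1 - β * αT) = αc := div_mul_cancel₀ _ (by linarith)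
    linarith
  obtain ⟨C, hC⟩ : ∃ C, ∀ x, |J x| ≤ C := by
    obtain ⟨C, hC⟩ := (isCompact_range hJcont.abs).bddAbove
    exact ⟨C, fun x => hC ⟨x, rfl⟩⟩
  obtain ⟨D, hD⟩ := (Set.finite_range fun i => |V i|).bddAbove
  have hbdd : BddAbove (Set.range fun x₀ : X => |V (Q.index x₀) - J x₀|) :=
    ⟨D + C, Set.forall_mem_range.2 fun x =>
      (abs_sub _ _).trans (add_le_add (hD ⟨Q.index x, rfl⟩) (hC x))⟩
  refine ⟨hbdd, ?_⟩
  set d := ⨆ x₀ : X, |V (Q.index x₀) - J x₀|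
  -- Both sides are minima over actions of one-step values, so it is enough to fix the action.
  have hstep : ∀ x, |V (Q.index x) - J x| ≤ K * Q.maxDiam + β * d := fun x => by
    rw [← hVfix, ← hJfix]
    refine abs_ciInf_sub_ciInf_le fun u => Q.abs_qValue_finiteModel_sub_le m hβ0.le V
      hJcont.measurable hC (fun y => le_ciSup hbdd y) u x fun z hz => ?_
    refine (m.abs_qValue_sub_le hβ0.le hαT.le hcost htrans hJcont.measurable hC hK hJlip
      z x u).trans ?_
    rw [hKfix]
    exact mul_le_mul_of_nonneg_left (Q.dist_le_maxDiam hz) hK.le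
  have hd : d ≤ K * Q.maxDiam + β * d := ciSup_le hstep
  have h1β : 0 < 1 - β := by linarith
  rw [← div_div, ← hKdef, div_mul_eq_mul_div, le_div_iff₀ h1β]
  linarith
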